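/- Let $V\subseteq\mathbb{R}^n$ be open, let $f:\mathbb{R}^n\times\mathbb{R}^m\to\mathbb{R}^n$ and $f^0:\mathbb{R}^n\times\mathbb{R}^m\to\mathbb{R}$ be of class $C^\infty$, let $T>0$ be fixed and let $x_0,x_1\in\mathbb{R}^n$. The admissible controls are all bounded measurable maps $u:[0,T]\to\mathbb{R}^m$ (no constraint on the values). A trajectory associated with $u$ is an absolutely continuous $x:[0,T]\to V$ with $\dot x(t)=f(x(t),u(t))$ for almost every $t\in[0,T]$. Consider the problem of minimizing $$C(u)=\int_0^T f^0(x(t),u(t))\,dt$$ over all admissible controls $u$ that have an associated trajectory $x$ on $[0,T]$ with $x(0)=x_0$ and $x(T)=x_1$. Write $\tilde x=(x,x^0)\in\mathbb{R}^{n}\times\mathbb{R}=\mathbb{R}^{n+1}$, $\tilde f(\tilde x,u)=(f(x,u),f^0(x,u))$ and, for $\tilde p\in\mathbb{R}^{n+1}$, $$\tilde H(\tilde x,\tilde p,u)=\langle\tilde p,\tilde f(\tilde x,u)\rangle .$$ **Theorem (weak Maximum Principle, Hestenes).** Let $u^*$ be an optimal control with associated trajectory $x^*$, and let $\tilde x^*(t)=\bigl(x^*(t),\int_0^t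 f^0(x^*(s),u^*(s))\,ds\bigr)$ be the corresponding trajectory of the augmented system $\dot{\tilde x}=\tilde f(\tilde x,u)$ starting at $(x_0,0)$. Then there is an absolutely continuous map $\tilde p^*:[0,T]\to\mathbb{R}^{n+1}\setminus\{0\}$ (it vanishes at no time) such that $\tilde x^*$ is absolutely continuous and, for almost every $t\in[0,T]$, the Hamiltonian system $$\dot{\tilde x}^*(t)=\frac{\partial\tilde H}{\partial\tilde p}(\tilde x^*(t),\tilde p^*(t),u^*(t)),\qquad \dot{\tilde p}^*(t)=-\frac{\partial\tilde H}{\partial\tilde x}(\tilde x^*(t),\tilde p^*(t),u^*(t))$$ and the stationarity condition $$\frac{\partial\tilde H}{\partial u}(\tilde x^*(t),\tilde p^*(t),u^*(t))=0$$ hold. -/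

import Mathlib

open MeasureTheory Set
open scoped ContDiff RealInnerProductSpace Gradient

noncomputable section

/-- The Euclidean space `ℝᵏ`. -/
abbrev Vec (k : ℕ) : Type := EuclideanSpace ℝ (Fin k)

/-- The point `(x, c)` of `ℝⁿ⁺¹ = ℝⁿ × ℝ`: the first `n` coordinates are those of `x`, the last
one is `c`. -/
def augment {n : ℕ} (x : Vec n) (c : ℝ) : Vec (n + 1) :=
  WithLp.toLp 2 (Fin.snoc (α := fun _ => ℝ) (fun i => x i) c)

/-- The component `x` of `x̃ = (x, x⁰)`, that is, the first `n` coordinates. -/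
def statePart {n : ℕ} (X : Vec (n + 1)) : Vec n :=
  WithLp.toLp 2 (fun i => X i.castSucc)

/-- An admissible control on `[0, T]`: a bounded (Lebesgue) measurable map from `[0, T]` to `ℝᵐ`,
with no constraint on its values. It is encoded by a function on `ℝ` of which only the
values on `[0, T]` matter. -/
structure IsAdmissibleControl {m : ℕ} (T : ℝ) (u : ℝ → Vec m) : Prop where
  measurable : AEMeasurable u (volume.restrict (Icc 0 T))
  bounded : ∃ C : ℝ, ∀ t ∈ Icc 0 T, ‖u t‖ ≤ C

/-- `x` is a trajectory in `V`, over `[0, T]`, of the control system `x' = f(x, u)` associated with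
the control `u`: it is absolutely continuous on `[0, T]`, it stays in `V`, and it solves the
equation at almost every time. -/
structure IsTrajectory {n m : ℕ} (V : Set (Vec n)) (f : Vec n × Vec m → Vec n) (T : ℝ)
    (u : ℝ → Vec m) (x : ℝ → Vec n) : Prop where
  absolutelyContinuous : AbsolutelyContinuousOnInterval x 0 T
  mem : ∀ t ∈ Icc 0 T, x t ∈ V
  hasDerivAt : ∀ᵐ t ∂volume.restrict (Icc 0 T), HasDerivAt x (f (x t, u t)) t

/-- `(x, u)` is feasible: `u` is admissible and `x` is an associated trajectory with
`x(0) = x₀` and `x(T) = x₁`. -/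
structure IsFeasible {n m : ℕ} (V : Set (Vec n)) (f : Vec n × Vec m → Vec n) (T : ℝ)
    (x₀ x₁ : Vec n) (x : ℝ → Vec n) (u : ℝ → Vec m) : Prop where
  control : IsAdmissibleControl T u
  trajectory : IsTrajectory V f T u x
  initial : x 0 = x₀
  final : x T = x₁

/-- The cost `C(u) = ∫₀ᵀ f⁰(x(t), u(t)) dt`. -/
def cost {n m : ℕ} (f0 : Vec n × Vec m → ℝ) (T : ℝ) (x : ℝ → Vec n) (u : ℝ → Vec m) : ℝ :=
  ∫ t in (0 : ℝ)..T, f0 (x t, u t)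

/-- The control `u`, with associated trajectory `x`, is optimal: it minimizes the cost among all
admissible controls whose trajectory is defined on `[0, T]` and joins `x₀` to `x₁`. -/
structure IsOptimal {n m : ℕ} (V : Set (Vec n)) (f : Vec n × Vec m → Vec n)
    (f0 : Vec n × Vec m → ℝ) (T : ℝ) (x₀ x₁ : Vec n) (x : ℝ → Vec n) (u : ℝ → Vec m) : Prop where
  feasible : IsFeasible V f T x₀ x₁ x u
  minimal : ∀ (y : ℝ → Vec n) (v : ℝ → Vec m), IsFeasible V f T x₀ x₁ y v →
    cost f0 T x u ≤ cost f0 T y v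

/-- The augmented dynamics `f̃(x̃, u) = (f(x, u), f⁰(x, u))`, where `x̃ = (x, x⁰)`. -/
def augDynamics {n m : ℕ} (f : Vec n × Vec m → Vec n) (f0 : Vec n × Vec m → ℝ)
    (X : Vec (n + 1)) (u : Vec m) : Vec (n + 1) :=
  augment (f (statePart X, u)) (f0 (statePart X, u))

/-- The augmented trajectory `x̃(t) = (x(t), ∫₀ᵗ f⁰(x(s), u(s)) ds)`, which leaves `(x(0), 0)`. -/
def augTrajectory {n m : ℕ} (f0 : Vec n × Vec m → ℝ) (x : ℝ → Vec n) (u : ℝ → Vec m)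
    (t : ℝ) : Vec (n + 1) :=
  augment (x t) (∫ s in (0 : ℝ)..t, f0 (x s, u s))

/-- The Hamiltonian `H̃(x̃, p̃, u) = ⟨p̃, f̃(x̃, u)⟩` of the augmented system. -/
def augHamiltonian {n m : ℕ} (f : Vec n × Vec m → Vec n) (f0 : Vec n × Vec m → ℝ)
    (X P : Vec (n + 1)) (u : Vec m) : ℝ :=
  ⟪P, augDynamics f f0 X u⟫

/-- `(x̃, p̃, u)` is an extremal on `[0, T]`: `x̃` and `p̃` are absolutely continuous and, at almost
every time, they solve the Hamiltonian system
`x̃' = ∂H̃/∂p̃`, `p̃' = -∂H̃/∂x̃` and the stationarity condition `∂H̃/∂u = 0` holds. -/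
structure IsExtremal {n m : ℕ} (f : Vec n × Vec m → Vec n) (f0 : Vec n × Vec m → ℝ) (T : ℝ)
    (X P : ℝ → Vec (n + 1)) (u : ℝ → Vec m) : Prop where
  absolutelyContinuous_state : AbsolutelyContinuousOnInterval X 0 T
  absolutelyContinuous_adjoint : AbsolutelyContinuousOnInterval P 0 T
  state : ∀ᵐ t ∂volume.restrict (Icc 0 T),
    HasDerivAt X (∇ (fun p => augHamiltonian f f0 (X t) p (u t)) (P t)) t
  adjoint : ∀ᵐ t ∂volume.restrict (Icc 0 T),
    HasDerivAt P (-∇ (fun z => augHamiltonian f f0 z (P t) (u t)) (X t)) t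
  stationarity : ∀ᵐ t ∂volume.restrict (Icc 0 T),
    ∇ (fun w => augHamiltonian f f0 (X t) (P t) w) (u t) = 0

end

/-! If the end-point map of the augmented system were open at the optimal control, some nearby
trajectory would join the same points `x₀`, `x₁` with smaller cost. So the linearized end-point map
is not onto, and some `ψ ≠ 0` annihilates its range. The adjoint vector is the solution of `p' = -Aᵀ
p` with `p(T) = ψ`, where `A` and `B` are the partial derivatives of the dynamics in state and
control.

Openness (`eventually_exists_trajectory_of_linearized_controllable`) is obtained without a flow:
state and control perturbations are independent unknowns in spaces of continuous functions, the
integral equation is one component of a strictly differentiable map, the end point is the other, and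
a surjective strict derivative gives openness. Continuous perturbations of the merely measurable
control suffice, since by `exists_adjoint_vector` they already force `Bᵀ p = 0` almost everywhere.
Optimality enters only through `IsOptimal.not_eventually_exists_trajectory`. -/

/-! ### Bounded measurable functions and their primitives. -/

/-- A bounded, almost everywhere strongly measurable function on the real line. -/
structure IsBoundedMeasurable {E : Type*} [NormedAddCommGroup E] (g : ℝ → E) : Prop where
  aesm : AEStronglyMeasurable g volume
  bdd : ∃ C, ∀ t, ‖g t‖ ≤ C

namespace IsBoundedMeasurable

variable {E F G : Type*} [NormedAddCommGroup E] [NormedAddCommGroup F] [NormedAddCommGroup G]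

theorem locallyIntegrable {g : ℝ → E} (hg : IsBoundedMeasurable g) : LocallyIntegrable g := by
  obtain ⟨C, hC⟩ := hg.bdd
  refine (locallyIntegrable_const (C : ℝ)).mono hg.aesm (Filter.Eventually.of_forall fun t => ?_)
  exact (hC t).trans (le_abs_self C)

theorem intervalIntegrable {g : ℝ → E} (hg : IsBoundedMeasurable g) (a b : ℝ) :
    IntervalIntegrable g volume a b :=
  (hg.locallyIntegrable.integrableOn_isCompact isCompact_uIcc).intervalIntegrable

theorem add {f g : ℝ → E} (hf : IsBoundedMeasurable f) (hg : IsBoundedMeasurable g) :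
    IsBoundedMeasurable fun t => f t + g t := by
  obtain ⟨C, hC⟩ := hf.bdd
  obtain ⟨D, hD⟩ := hg.bdd
  exact ⟨hf.aesm.add hg.aesm, C + D, fun t => norm_add_le_of_le (hC t) (hD t)⟩

theorem prodMk {f : ℝ → E} {g : ℝ → F} (hf : IsBoundedMeasurable f)
    (hg : IsBoundedMeasurable g) : IsBoundedMeasurable fun t => (f t, g t) := by
  obtain ⟨C, hC⟩ := hf.bdd
  obtain ⟨D, hD⟩ := hg.bdd
  exact ⟨hf.aesm.prodMk hg.aesm, max C D, fun t => max_le_max (hC t) (hD t)⟩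

/-- Bounded sets are relatively compact in a proper space, so the dynamics and its derivatives stay
bounded along a trajectory without any growth condition. -/
theorem comp_continuous [ProperSpace E] {φ : E → F} (hφ : Continuous φ) {g : ℝ → E}
    (hg : IsBoundedMeasurable g) : IsBoundedMeasurable fun t => φ (g t) := by
  obtain ⟨C, hC⟩ := hg.bdd
  obtain ⟨D, hD⟩ := (isCompact_closedBall (0 : E) C).exists_bound_of_continuousOn hφ.continuousOn
  exact ⟨hφ.comp_aestronglyMeasurable hg.aesm, D, fun t => hD _ (by simpa using hC t)⟩

theorem iccExtend {T : ℝ} (hT : 0 ≤ T) (z : C(Icc (0 : ℝ) T, E)) :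
    IsBoundedMeasurable (IccExtend hT z) :=
  ⟨z.continuous.Icc_extend'.aestronglyMeasurable, ‖z‖, fun _ => z.norm_coe_le_norm _⟩

variable [NormedSpace ℝ E] [NormedSpace ℝ F] [NormedSpace ℝ G]

theorem lipschitz_integral {g : ℝ → E} (hg : IsBoundedMeasurable g) :
    ∃ K, LipschitzWith K fun t => ∫ s in (0 : ℝ)..t, g s := by
  obtain ⟨C, hC⟩ := hg.bdd
  refine ⟨C.toNNReal, LipschitzWith.of_dist_le_mul fun x y => ?_⟩
  have h0 : 0 ≤ C := (norm_nonneg _).trans (hC 0)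
  rw [dist_eq_norm, intervalIntegral.integral_interval_sub_left (hg.intervalIntegrable _ _)
    (hg.intervalIntegrable _ _), Real.coe_toNNReal _ h0, Real.dist_eq]
  exact intervalIntegral.norm_integral_le_of_norm_le_const fun t _ => hC t

theorem ae_hasDerivAt [CompleteSpace E] {g : ℝ → E} (hg : IsBoundedMeasurable g) :
    ∀ᵐ t, HasDerivAt (fun t => ∫ s in (0 : ℝ)..t, g s) (g t) t := by
  filter_upwards [LocallyIntegrable.ae_hasDerivAt_integral hg.locallyIntegrable] with t ht using ht 0

/-- The fundamental theorem of calculus for absolutely continuous functions with bounded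
derivative. -/
theorem eq_add_integral [CompleteSpace E] {g f : ℝ → E} (hg : IsBoundedMeasurable g) {T : ℝ}
    (hT : 0 ≤ T) (hf : AbsolutelyContinuousOnInterval f 0 T)
    (hfg : ∀ᵐ t, t ∈ Icc 0 T → HasDerivAt f (g t) t) :
    ∀ t ∈ Icc 0 T, f t = f 0 + ∫ s in (0 : ℝ)..t, g s := by
  obtain ⟨K, hK⟩ := hg.lipschitz_integral
  -- The difference between `f` and the primitive of `g` is absolutely continuous with derivative
  -- zero almost everywhere, hence constant.
  obtain ⟨C, hC⟩ := (hf.sub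
    (hK.lipschitzOnWith (s := uIcc 0 T)).absolutelyContinuousOnInterval).const_of_ae_hasDerivAt_zero
    (by
      filter_upwards [hfg, hg.ae_hasDerivAt] with t h1 h2 ht
      rw [uIcc_of_le hT] at ht
      simpa using (h1 ht).sub h2)
  rw [uIcc_of_le hT] at hC
  intro t ht
  have h0 := hC 0 ⟨le_rfl, hT⟩
  have h1 := hC t ht
  simp only [Pi.sub_apply, intervalIntegral.integral_same, sub_zero] at h0 h1
  rw [h0, ← h1]
  abel

theorem bilin (L : E →L[ℝ] F →L[ℝ] G) {f : ℝ → E} {g : ℝ → F} (hf : IsBoundedMeasurable f)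
    (hg : IsBoundedMeasurable g) : IsBoundedMeasurable fun t => L (f t) (g t) := by
  obtain ⟨C, hC⟩ := hf.bdd
  obtain ⟨D, hD⟩ := hg.bdd
  refine ⟨L.aestronglyMeasurable_comp₂ hf.aesm hg.aesm, ‖L‖ * C * D, fun t => ?_⟩
  have h0 : 0 ≤ C := (norm_nonneg _).trans (hC t)
  exact (L.le_opNorm₂ _ _).trans (by gcongr <;> aesop)

theorem clm_apply {A : ℝ → E →L[ℝ] F} {g : ℝ → E} (hA : IsBoundedMeasurable A)
    (hg : IsBoundedMeasurable g) : IsBoundedMeasurable fun t => A t (g t) :=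
  bilin (ContinuousLinearMap.id ℝ (E →L[ℝ] F)) hA hg

end IsBoundedMeasurable

/-- The inner product of two Lipschitz functions is absolutely continuous. -/
theorem LipschitzWith.absolutelyContinuousOnInterval_inner {E : Type*} [NormedAddCommGroup E]
    [InnerProductSpace ℝ E] {f g : ℝ → E} {K L : NNReal} (hf : LipschitzWith K f)
    (hg : LipschitzWith L g) (a b : ℝ) :
    AbsolutelyContinuousOnInterval (fun t => ⟪f t, g t⟫) a b := by
  obtain ⟨C, hC⟩ := isCompact_uIcc (a := a) (b := b) |>.exists_bound_of_continuousOn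
    hf.continuous.continuousOn
  obtain ⟨D, hD⟩ := isCompact_uIcc (a := a) (b := b) |>.exists_bound_of_continuousOn
    hg.continuous.continuousOn
  have hC0 : 0 ≤ C := (norm_nonneg _).trans (hC a left_mem_uIcc)
  have hD0 : 0 ≤ D := (norm_nonneg _).trans (hD a left_mem_uIcc)
  refine LipschitzOnWith.absolutelyContinuousOnInterval
    (K := C.toNNReal * L + K * D.toNNReal) (LipschitzOnWith.of_dist_le_mul fun s hs t ht => ?_)
  have key : ⟪f s, g s⟫ - ⟪f t, g t⟫ = ⟪f s, g s - g t⟫ + ⟪f s - f t, g t⟫ := by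
    simp only [inner_sub_left, inner_sub_right]; ring
  have h1 := hf.dist_le_mul s t
  have h2 := hg.dist_le_mul s t
  rw [dist_eq_norm] at h1 h2
  push_cast
  rw [Real.coe_toNNReal _ hC0, Real.coe_toNNReal _ hD0, Real.dist_eq, key, add_mul]
  refine (abs_add_le _ _).trans (add_le_add ?_ ?_)
  · refine (abs_real_inner_le_norm _ _).trans ?_
    calc _ ≤ C * (L * dist s t) := mul_le_mul (hC s hs) h2 (norm_nonneg _) hC0
      _ = _ := by ring
  · refine (abs_real_inner_le_norm _ _).trans ?_
    calc _ ≤ (K * dist s t) * D := mul_le_mul h1 (hD t ht) (norm_nonneg _) (by positivity)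
      _ = _ := by ring

/-! ### Linear Volterra equations and linear differential equations. -/

section Linear

variable {E F : Type*} [NormedAddCommGroup E] [NormedSpace ℝ E]
  [NormedAddCommGroup F] [NormedSpace ℝ F]

/-- The primitive of a bounded measurable function, as a continuous function on `[0, T]`. -/
theorem IsBoundedMeasurable.exists_primitive {g : ℝ → E} (hg : IsBoundedMeasurable g) (T : ℝ) :
    ∃ G : C(Icc (0 : ℝ) T, E), ∀ t, G t = ∫ s in (0 : ℝ)..t, g s := by
  obtain ⟨K, hK⟩ := hg.lipschitz_integral
  exact ⟨⟨fun t => ∫ s in (0 : ℝ)..t, g s, hK.continuous.comp continuous_subtype_val⟩,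
    fun t => rfl⟩

/-- The Volterra operator `z ↦ ∫₀ᵗ A(s) z(s) ds` on continuous functions. -/
theorem exists_volterra {T : ℝ} (hT : 0 ≤ T) {A : ℝ → E →L[ℝ] F} (hA : IsBoundedMeasurable A) :
    ∃ L : C(Icc (0 : ℝ) T, E) →L[ℝ] C(Icc (0 : ℝ) T, F),
      ∀ z t, L z t = ∫ s in (0 : ℝ)..t, A s (IccExtend hT z s) := by
  have hz (z : C(Icc (0 : ℝ) T, E)) := hA.clm_apply (IsBoundedMeasurable.iccExtend hT z)
  choose L hL using fun z => (hz z).exists_primitive T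
  obtain ⟨C, hC⟩ := hA.bdd
  have hC0 : 0 ≤ C := (norm_nonneg _).trans (hC 0)
  refine ⟨LinearMap.mkContinuous ⟨⟨L, fun y z => ?_⟩, fun c z => ?_⟩ (C * T) fun z => ?_, hL⟩
  · ext t
    rw [ContinuousMap.add_apply, hL, hL, hL, ← intervalIntegral.integral_add
      ((hz y).intervalIntegrable _ _) ((hz z).intervalIntegrable _ _)]
    simp [IccExtend]
  · ext t
    simp only [ContinuousMap.smul_apply, hL, RingHom.id_apply]
    rw [← intervalIntegral.integral_smul]
    simp [IccExtend]
  · refine (ContinuousMap.norm_le _ (by positivity)).2 fun t => ?_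
    change ‖L z t‖ ≤ _
    rw [hL]
    refine (intervalIntegral.norm_integral_le_of_norm_le_const (C := C * ‖z‖) fun s _ => ?_).trans ?_
    · exact ((A s).le_opNorm _).trans (mul_le_mul (hC s) (z.norm_coe_le_norm _) (norm_nonneg _) hC0)
    · rw [sub_zero, abs_of_nonneg t.2.1]
      calc _ ≤ C * ‖z‖ * T := by gcongr; exact t.2.2
        _ = _ := by ring

/-- Linear Volterra equations `h(t) = φ(t) + ∫₀ᵗ A(s) h(s) ds` are solvable. -/
theorem exists_linear_volterra_solution [CompleteSpace E] {T : ℝ} (hT : 0 ≤ T)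
    {A : ℝ → E →L[ℝ] E} (hA : IsBoundedMeasurable A) (φ : C(Icc (0 : ℝ) T, E)) :
    ∃ h : C(Icc (0 : ℝ) T, E),
      ∀ t, h t = φ t + ∫ s in (0 : ℝ)..t, A s (IccExtend hT h s) := by
  obtain ⟨L, hL⟩ := exists_volterra hT hA
  obtain ⟨C, hC⟩ := hA.bdd
  have hC0 : 0 ≤ C := (norm_nonneg _).trans (hC 0)
  -- Conjugating the Volterra operator by the weight `exp (l t)` brings its norm down to at most `C
  -- / l < 1`, so a Neumann series solves the equation on all of `[0, T]` at once.
  set l : ℝ := C + 1 with hl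
  have hl0 : 0 < l := by positivity
  let e (c : ℝ) : C(Icc (0 : ℝ) T, ℝ) := ⟨fun t => Real.exp (c * t), by fun_prop⟩
  have key (z : C(Icc (0 : ℝ) T, E)) (t : Icc (0 : ℝ) T) :
      ‖(e (-l) • L (e l • z)) t‖ ≤ C / l * ‖z‖ := by
    have h1 : ‖L (e l • z) t‖ ≤ ∫ s in (0 : ℝ)..t, C * ‖z‖ * Real.exp (l * s) := by
      rw [hL]
      refine intervalIntegral.norm_integral_le_of_norm_le t.2.1
        (Filter.Eventually.of_forall fun s hs => ?_)
        (Continuous.intervalIntegrable (by fun_prop) _ _)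
      have hs' : s ∈ Icc 0 T := ⟨hs.1.le, hs.2.trans t.2.2⟩
      rw [IccExtend_of_mem _ _ hs']
      have : ‖(e l • z) ⟨s, hs'⟩‖ ≤ Real.exp (l * s) * ‖z‖ := by
        simp only [ContinuousMap.smul_apply', norm_smul, e, ContinuousMap.coe_mk,
          Real.norm_eq_abs, Real.abs_exp]
        gcongr
        exact z.norm_coe_le_norm _
      calc _ ≤ C * (Real.exp (l * s) * ‖z‖) :=
            ((A s).le_opNorm _).trans (mul_le_mul (hC s) this (norm_nonneg _) hC0)
        _ = _ := by ring
    have h2 : ∫ s in (0 : ℝ)..t, C * ‖z‖ * Real.exp (l * s)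
        = C * ‖z‖ * ((Real.exp (l * t) - 1) / l) := by
      rw [intervalIntegral.integral_const_mul,
        intervalIntegral.integral_comp_mul_left (fun x => Real.exp x) hl0.ne', integral_exp]
      simp [div_eq_inv_mul]
    simp only [ContinuousMap.smul_apply', norm_smul, e, ContinuousMap.coe_mk,
      Real.norm_eq_abs, Real.abs_exp]
    rw [h2] at h1
    calc _ ≤ Real.exp (-l * t) * (C * ‖z‖ * ((Real.exp (l * t) - 1) / l)) := by gcongr
      _ = C / l * ‖z‖ * (1 - Real.exp (-l * t)) := by
          have : Real.exp (-l * t) * Real.exp (l * t) = 1 := by rw [← Real.exp_add]; simp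
          linear_combination C * ‖z‖ / l * this
      _ ≤ C / l * ‖z‖ * 1 := by
          gcongr
          linarith [Real.exp_pos (-l * t)]
      _ = _ := mul_one _
  let M : C(Icc (0 : ℝ) T, E) →L[ℝ] C(Icc (0 : ℝ) T, E) :=
    LinearMap.mkContinuous ⟨⟨fun z => e (-l) • L (e l • z), fun y z => by
      simp [smul_add]⟩, fun c z => by
      have : e l • c • z = c • e l • z := by ext t; simp [smul_comm c]
      ext t
      simp [this, smul_comm c]⟩ (C / l) fun z =>
        (ContinuousMap.norm_le _ (by positivity)).2 (key z)
  have hM : ‖M‖ < 1 := by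
    refine (LinearMap.mkContinuous_norm_le _ (by positivity) _).trans_lt ?_
    rw [div_lt_one hl0]
    linarith
  obtain ⟨U, hU⟩ := isUnit_one_sub_of_norm_lt_one
    (R := C(Icc (0 : ℝ) T, E) →L[ℝ] C(Icc (0 : ℝ) T, E)) hM
  set k := (U⁻¹).1 (e (-l) • φ) with hk
  have h1 : k - M k = e (-l) • φ := by
    have : ((1 : C(Icc (0 : ℝ) T, E) →L[ℝ] C(Icc (0 : ℝ) T, E)) - M) k = e (-l) • φ :=
      hU ▸ DFunLike.congr_fun U.mul_inv (e (-l) • φ)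
    simpa using this
  refine ⟨e l • k, fun t => ?_⟩
  rw [← hL]
  have h2 := congrArg (fun z => (e l) t • z t) h1
  have h3 : e l t * e (-l) t = 1 := by
    simp only [e, ContinuousMap.coe_mk]; rw [← Real.exp_add]; simp
  change e l t • (k t - e (-l) t • L (e l • k) t) = e l t • (e (-l) t • φ t) at h2
  rw [smul_sub, smul_smul, smul_smul, h3, one_smul, one_smul, sub_eq_iff_eq_add] at h2
  exact h2

/-- The Cauchy problem at time `0` for the linear equation `p' = A(t) p`. -/
theorem exists_linear_ode_solution [CompleteSpace E] {T : ℝ} (hT : 0 ≤ T)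
    {A : ℝ → E →L[ℝ] E} (hA : IsBoundedMeasurable A) (e : E) :
    ∃ P : ℝ → E, P 0 = e ∧ (∃ K, LipschitzWith K P) ∧
      ∀ᵐ t, t ∈ Icc 0 T → HasDerivAt P (A t (P t)) t := by
  obtain ⟨h, hh⟩ := exists_linear_volterra_solution hT hA (ContinuousMap.const _ e)
  have hb := hA.clm_apply (IsBoundedMeasurable.iccExtend hT h)
  obtain ⟨K, hK⟩ := hb.lipschitz_integral
  refine ⟨fun t => e + ∫ s in (0 : ℝ)..t, A s (IccExtend hT h s), by simp, ⟨K, ?_⟩, ?_⟩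
  · simpa using (LipschitzWith.const e).add hK
  · filter_upwards [hb.ae_hasDerivAt] with t ht htm
    have := hh ⟨t, htm⟩
    rw [ContinuousMap.const_apply] at this
    rw [← this]
    rw [IccExtend_of_mem _ _ htm] at ht
    exact ht.const_add e

/-- The Cauchy problem at time `T` for the linear equation `p' = A(t) p`. -/
theorem exists_linear_ode_solution_final [CompleteSpace E] {T : ℝ} (hT : 0 ≤ T)
    {A : ℝ → E →L[ℝ] E} (hA : IsBoundedMeasurable A) (e : E) :
    ∃ P : ℝ → E, P T = e ∧ (∃ K, LipschitzWith K P) ∧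
      ∀ᵐ t, t ∈ Icc 0 T → HasDerivAt P (A t (P t)) t := by
  have hmp := (Measure.measurePreserving_sub_left volume T).quasiMeasurePreserving
  -- Time reversal `t ↦ T - t` turns the final condition into an initial one.
  have hB : IsBoundedMeasurable fun t => -A (T - t) := by
    obtain ⟨C, hC⟩ := hA.bdd
    exact ⟨(hA.aesm.comp_quasiMeasurePreserving hmp).neg, C, fun t => by simpa using hC _⟩
  obtain ⟨Q, hQ0, ⟨K, hK⟩, hQ⟩ := exists_linear_ode_solution hT hB e
  refine ⟨fun t => Q (T - t), by simpa using hQ0, ⟨K, ?_⟩, ?_⟩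
  · refine LipschitzWith.of_dist_le_mul fun x y => (hK.dist_le_mul _ _).trans ?_
    rw [dist_sub_left]
  · filter_upwards [hmp.ae hQ] with t ht htm
    have := ht ⟨by linarith [htm.2], by linarith [htm.1]⟩
    have h2 := this.scomp t ((hasDerivAt_id t).const_sub T)
    simpa [Function.comp_def] using h2

end Linear

/-! ### Openness of the end-point map. -/

section EndPoint

/-- The map `ζ ↦ ∫₀ᵗ G(z₀(s) + ζ(s)) ds` on continuous functions is strictly differentiable at
`0`. -/
theorem exists_hasStrictFDerivAt_integral_superposition {X E : Type*} [NormedAddCommGroup X]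
    [NormedSpace ℝ X] [ProperSpace X] [NormedAddCommGroup E] [NormedSpace ℝ E] {G : X → E}
    (hG : ContDiff ℝ 1 G) {z₀ : ℝ → X} (hz₀ : IsBoundedMeasurable z₀) {T : ℝ} (hT : 0 ≤ T) :
    ∃ (Ψ : C(Icc (0 : ℝ) T, X) → C(Icc (0 : ℝ) T, E))
      (L : C(Icc (0 : ℝ) T, X) →L[ℝ] C(Icc (0 : ℝ) T, E)),
      (∀ ζ t, Ψ ζ t = ∫ s in (0 : ℝ)..t, G (z₀ s + IccExtend hT ζ s)) ∧
      (∀ ζ t, L ζ t = ∫ s in (0 : ℝ)..t, fderiv ℝ G (z₀ s) (IccExtend hT ζ s)) ∧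
      HasStrictFDerivAt Ψ L 0 := by
  have hG' : Continuous (fderiv ℝ G) := hG.continuous_fderiv one_ne_zero
  have hA : IsBoundedMeasurable fun s => fderiv ℝ G (z₀ s) := hz₀.comp_continuous hG'
  have hN (ζ : C(Icc (0 : ℝ) T, X)) :
      IsBoundedMeasurable fun s => G (z₀ s + IccExtend hT ζ s) :=
    (hz₀.add (IsBoundedMeasurable.iccExtend hT ζ)).comp_continuous hG.continuous
  choose Ψ hΨ using fun ζ => (hN ζ).exists_primitive T
  obtain ⟨L, hL⟩ := exists_volterra hT hA
  refine ⟨Ψ, L, hΨ, hL, .of_isLittleO (Asymptotics.isLittleO_iff.2 fun ε hε => ?_)⟩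
  obtain ⟨C, hC⟩ := hz₀.bdd
  have huc := (isCompact_closedBall (0 : X) (C + 1)).uniformContinuousOn_of_continuous
    hG'.continuousOn
  -- Integration over `[0, T]` costs a factor at most `T`; `T + 1` also covers `T = 0`.
  have hε' : 0 < ε / (T + 1) := by positivity
  obtain ⟨δ, hδ, huc⟩ := Metric.uniformContinuousOn_iff.1 huc _ hε'
  -- The bound `1` keeps all points in the ball of radius `C + 1`, where the derivative is uniformly
  -- continuous; this makes the estimate uniform in `s` although `z₀` is only measurable.
  have hr : 0 < min δ 1 := lt_min hδ one_pos
  have hb : Metric.ball (0 : C(Icc (0 : ℝ) T, X) × C(Icc (0 : ℝ) T, X)) (min δ 1) ∈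
      nhds ((0, 0) : C(Icc (0 : ℝ) T, X) × C(Icc (0 : ℝ) T, X)) := Metric.ball_mem_nhds _ hr
  filter_upwards [hb] with ⟨ζ, η⟩ hp
  rw [mem_ball_zero_iff, Prod.norm_def, max_lt_iff] at hp
  have hpt (s : ℝ) : ‖G (z₀ s + IccExtend hT ζ s) - G (z₀ s + IccExtend hT η s)
      - fderiv ℝ G (z₀ s) (IccExtend hT (ζ - η) s)‖ ≤ ε / (T + 1) * ‖ζ - η‖ := by
    have hmem {ξ : C(Icc (0 : ℝ) T, X)} (hξ : ‖ξ‖ < min δ 1) :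
        z₀ s + IccExtend hT ξ s ∈ Metric.ball (z₀ s) (min δ 1) := by
      rw [mem_ball_iff_norm, add_sub_cancel_left]
      exact (ξ.norm_coe_le_norm _).trans_lt hξ
    have := (convex_ball (z₀ s) (min δ 1)).norm_image_sub_le_of_norm_fderiv_le' (𝕜 := ℝ) (f := G)
      (φ := fderiv ℝ G (z₀ s)) (C := ε / (T + 1))
      (fun x _ => (hG.differentiable one_ne_zero) x) (fun x hx => ?_) (hmem hp.2) (hmem hp.1)
    · rw [add_sub_add_left_eq_sub] at this
      refine this.trans ?_
      gcongr
      exact (ζ - η).norm_coe_le_norm _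
    · rw [mem_ball_iff_norm, lt_min_iff] at hx
      rw [← dist_eq_norm]
      refine (huc _ ?_ _ ?_ ?_).le
      · rw [mem_closedBall_zero_iff]
        calc ‖x‖ = ‖z₀ s + (x - z₀ s)‖ := by simp
          _ ≤ C + 1 := norm_add_le_of_le (hC s) hx.2.le
      · rw [mem_closedBall_zero_iff]
        exact (hC s).trans (by linarith)
      · rw [dist_eq_norm]; exact hx.1
  refine (ContinuousMap.norm_le _ (by positivity)).2 fun t => ?_
  simp only [ContinuousMap.sub_apply, hΨ, hL]
  rw [← intervalIntegral.integral_sub ((hN _).intervalIntegrable _ _)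
    ((hN _).intervalIntegrable _ _), ← intervalIntegral.integral_sub
    (((hN _).intervalIntegrable _ _).sub ((hN _).intervalIntegrable _ _))
    ((hA.clm_apply (IsBoundedMeasurable.iccExtend hT _)).intervalIntegrable _ _)]
  refine (intervalIntegral.norm_integral_le_of_norm_le_const fun s _ => hpt s).trans ?_
  rw [sub_zero, abs_of_nonneg t.2.1]
  calc _ ≤ ε / (T + 1) * ‖ζ - η‖ * (T + 1) := by gcongr; linarith [t.2.2]
    _ = _ := by field_simp

variable {E W : Type*} [NormedAddCommGroup E] [InnerProductSpace ℝ E] [FiniteDimensional ℝ E]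
  [NormedAddCommGroup W] [InnerProductSpace ℝ W] [FiniteDimensional ℝ W]

/-- A subspace on which no nonzero linear form vanishes is the whole space. -/
theorem Submodule.eq_top_of_forall_exists_inner_ne_zero (S : Submodule ℝ E)
    (h : ∀ ψ : E, ψ ≠ 0 → ∃ e ∈ S, ⟪ψ, e⟫ ≠ 0) : S = ⊤ := by
  have : CompleteSpace S := FiniteDimensional.complete ℝ S
  rw [← Submodule.orthogonal_eq_bot_iff, Submodule.eq_bot_iff]
  intro ψ hψ
  by_contra hne
  obtain ⟨e, he, hψe⟩ := h ψ hne
  exact hψe (Submodule.inner_left_of_mem_orthogonal he hψ)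

/-- If no nonzero linear form vanishes at the end points of all solutions `h` of the linearized
control system, then the end-point map of the control system `x' = F(x, u)` is open at the reference
trajectory: neighbouring end points are reached by neighbouring trajectories, with continuous
perturbations of the control. -/
theorem eventually_exists_trajectory_of_linearized_controllable {F : E × W → E}
    (hF : ContDiff ℝ 1 F) {x : ℝ → E} {u : ℝ → W} (hx : IsBoundedMeasurable x)
    (hu : IsBoundedMeasurable u) {T : ℝ} (hT : 0 ≤ T)
    (hctrl : ∀ ψ : E, ψ ≠ 0 → ∃ (h : C(Icc (0 : ℝ) T, E)) (v : C(Icc (0 : ℝ) T, W)),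
      (∀ t, h t = ∫ s in (0 : ℝ)..t,
        fderiv ℝ F (x s, u s) (IccExtend hT h s, IccExtend hT v s)) ∧
      ⟪ψ, h ⟨T, hT, le_rfl⟩⟫ ≠ 0)
    {ε : ℝ} (hε : 0 < ε) :
    ∀ᶠ e in nhds (0 : E), ∃ (h : C(Icc (0 : ℝ) T, E)) (v : C(Icc (0 : ℝ) T, W)), ‖h‖ < ε ∧
      (∀ t, h t = (∫ s in (0 : ℝ)..t, F (x s + IccExtend hT h s, u s + IccExtend hT v s))
        - ∫ s in (0 : ℝ)..t, F (x s, u s)) ∧ h ⟨T, hT, le_rfl⟩ = e := by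
  have : CompleteSpace E := FiniteDimensional.complete ℝ E
  have : CompleteSpace W := FiniteDimensional.complete ℝ W
  have : ProperSpace E := FiniteDimensional.proper_real E
  have : ProperSpace W := FiniteDimensional.proper_real W
  have hz₀ := hx.prodMk hu
  obtain ⟨Ψ, L, hΨ, hL, hΨL⟩ := exists_hasStrictFDerivAt_integral_superposition hF hz₀ hT
  let π : C(Icc (0 : ℝ) T, E × W) →L[ℝ] C(Icc (0 : ℝ) T, E) :=
    (ContinuousLinearMap.fst ℝ E W).compLeftContinuous ℝ _
  let ev : C(Icc (0 : ℝ) T, E) →L[ℝ] E := ContinuousMap.evalCLM ℝ ⟨T, hT, le_rfl⟩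
  let pair (h : C(Icc (0 : ℝ) T, E)) (v : C(Icc (0 : ℝ) T, W)) : C(Icc (0 : ℝ) T, E × W) :=
    h.prodMk v
  -- The first component vanishes exactly when the perturbed pair solves the integral equation; the
  -- second is the displacement of the end point.
  have hΘ : HasStrictFDerivAt (fun z => (π z - (Ψ z - Ψ 0), ev (π z)))
      ((π - L).prod (ev.comp π)) 0 :=
    (π.hasStrictFDerivAt.sub (hΨL.sub_const _)).prodMk (ev.comp π).hasStrictFDerivAt
  have hA : IsBoundedMeasurable fun s =>
      (fderiv ℝ F (x s, u s)).comp (ContinuousLinearMap.inl ℝ E W) :=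
    hz₀.comp_continuous (φ := fun q => (fderiv ℝ F q).comp (ContinuousLinearMap.inl ℝ E W))
      ((hF.continuous_fderiv one_ne_zero).clm_comp continuous_const)
  -- The end points reached by the linearized system.
  let S : Submodule ℝ E := ((π - L).ker).map (ev.comp π).toLinearMap
  have hS : S = ⊤ := by
    refine S.eq_top_of_forall_exists_inner_ne_zero fun ψ hψ => ?_
    obtain ⟨h, v, hhv, hψh⟩ := hctrl ψ hψ
    refine ⟨_, ⟨pair h v, ?_, rfl⟩, hψh⟩
    change π (pair h v) - L (pair h v) = 0
    rw [sub_eq_zero]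
    ext1 t
    rw [hL]
    exact hhv t
  have hsurj : ((π - L).prod (ev.comp π)).range = ⊤ := by
    rw [eq_top_iff]
    rintro ⟨φ, e⟩ -
    -- With zero control perturbation the component `φ` is attained; a linearized trajectory ending
    -- at `e - h(T)` then corrects the end point.
    obtain ⟨h, hh⟩ := exists_linear_volterra_solution hT hA φ
    have hz : (π - L) (pair h 0) = φ := by
      change π (pair h 0) - L (pair h 0) = φ
      rw [sub_eq_iff_eq_add]
      ext1 t
      rw [ContinuousMap.add_apply, hL]
      exact hh t
    obtain ⟨z, hz0, hze⟩ : e - ev h ∈ S := hS ▸ Submodule.mem_top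
    refine ⟨pair h 0 + z, Prod.ext ?_ ?_⟩
    · change (π - L) (pair h 0 + z) = φ
      rw [map_add, hz, show (π - L) z = 0 from hz0, add_zero]
    · change ev (π (pair h 0 + z)) = e
      rw [map_add, map_add, show ev (π z) = e - ev h from hze]
      exact add_sub_cancel _ _
  have hmap := hΘ.map_nhds_eq_of_surj hsurj
  have hball : {z : C(Icc (0 : ℝ) T, E × W) | ‖π z‖ < ε} ∈ nhds 0 :=
    (isOpen_lt (by fun_prop) continuous_const).mem_nhds (by simpa using hε)
  have hnhds := hmap ▸ Filter.image_mem_map hball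
  simp only [map_zero, sub_self] at hnhds
  have hcont : Filter.Tendsto (fun e : E => ((0 : C(Icc (0 : ℝ) T, E)), e)) (nhds 0)
      (nhds (0, 0)) := (Continuous.prodMk_right _).tendsto _
  filter_upwards [hcont hnhds] with e he
  obtain ⟨z, hz, hze⟩ := he
  rw [Prod.mk.injEq, sub_eq_zero] at hze
  refine ⟨π z, ⟨fun t => (z t).2, by fun_prop⟩, hz, fun t => ?_, hze.2⟩
  have h1 := congrArg (fun q => q t) hze.1
  simp only [ContinuousMap.sub_apply, hΨ] at h1
  have h0 : ∫ s in (0 : ℝ)..t, F ((x s, u s) + IccExtend hT (0 : C(Icc (0 : ℝ) T, E × W)) s)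
      = ∫ s in (0 : ℝ)..t, F (x s, u s) := by simp [IccExtend]
  rw [h0] at h1
  exact h1

end EndPoint

/-! ### The adjoint equation and stationarity. -/

section Adjoint

open ContinuousLinearMap (adjoint)

variable {E W : Type*} [NormedAddCommGroup E] [InnerProductSpace ℝ E] [CompleteSpace E]
  [NormedAddCommGroup W] [InnerProductSpace ℝ W] [CompleteSpace W]

/-- The adjoint of a bounded measurable family of operators is bounded measurable. -/
theorem IsBoundedMeasurable.adjoint {A : ℝ → W →L[ℝ] E} (hA : IsBoundedMeasurable A) :
    IsBoundedMeasurable fun t => adjoint (A t) := by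
  obtain ⟨C, hC⟩ := hA.bdd
  exact ⟨(LinearIsometryEquiv.continuous _).comp_aestronglyMeasurable hA.aesm, C, fun t => by
    simpa using hC t⟩

/-- Pairing a solution of `h' = A h + b` with a solution of the adjoint equation
`p' = -Aᵀ p`. -/
theorem inner_adjoint_solution_eq {T : ℝ} (hT : 0 ≤ T) {A : ℝ → E →L[ℝ] E} {P h b : ℝ → E}
    {K K' : NNReal} (hP : LipschitzWith K P) (hh : LipschitzWith K' h)
    (hPd : ∀ᵐ t, t ∈ Icc 0 T → HasDerivAt P (-adjoint (A t) (P t)) t)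
    (hhd : ∀ᵐ t, t ∈ Icc 0 T → HasDerivAt h (A t (h t) + b t) t) {c : ℝ → ℝ}
    (hc : IsBoundedMeasurable c) (hcb : ∀ t ∈ Icc 0 T, c t = ⟪P t, b t⟫) :
    ∀ t ∈ Icc 0 T, ⟪P t, h t⟫ = ⟪P 0, h 0⟫ + ∫ s in (0 : ℝ)..t, c s := by
  refine hc.eq_add_integral hT (hP.absolutelyContinuousOnInterval_inner hh 0 T) ?_
  filter_upwards [hPd, hhd] with t h1 h2 ht
  refine ((h1 ht).inner ℝ (h2 ht)).congr_deriv ?_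
  rw [hcb t ht, inner_neg_left, ContinuousLinearMap.adjoint_inner_left, inner_add_right]
  ring

/-- A solution of the adjoint equation which does not vanish at time `T` never vanishes. -/
theorem adjoint_solution_ne_zero {T : ℝ} (hT : 0 ≤ T) {A : ℝ → E →L[ℝ] E}
    (hA : IsBoundedMeasurable A) {P : ℝ → E} {K : NNReal} (hP : LipschitzWith K P)
    (hPd : ∀ᵐ t, t ∈ Icc 0 T → HasDerivAt P (-adjoint (A t) (P t)) t) (hPT : P T ≠ 0) :
    ∀ t ∈ Icc 0 T, P t ≠ 0 := by
  -- For this `h` the pairing `⟪P, h⟫` is constant, equal to `‖P T‖²`; a zero of `P` would make it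
  -- vanish.
  obtain ⟨h, hhT, ⟨K', hK'⟩, hhd⟩ := exists_linear_ode_solution_final hT hA (P T)
  have key := inner_adjoint_solution_eq hT hP hK' hPd (b := fun _ => 0) (by simpa using hhd)
    (c := fun _ => 0) ⟨aestronglyMeasurable_const, 0, by simp⟩ (by simp)
  simp only [intervalIntegral.integral_zero, add_zero] at key
  intro t ht h0
  have h1 := (key T ⟨hT, le_rfl⟩).trans (key t ht).symm
  rw [h0, hhT, inner_zero_left, inner_self_eq_zero] at h1
  exact hPT h1

/-- If the linear form `ψ ≠ 0` vanishes at the end points of all solutions of the linear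
control system `h' = A h + B v`, then the solution of the adjoint equation equal to `ψ` at
time `T` is a nowhere zero adjoint vector annihilating the range of `B`. -/
theorem exists_adjoint_vector {T : ℝ} (hT : 0 ≤ T) {A : ℝ → E →L[ℝ] E} {B : ℝ → W →L[ℝ] E}
    (hA : IsBoundedMeasurable A) (hB : IsBoundedMeasurable B) {ψ : E} (hψ : ψ ≠ 0)
    (hψT : ∀ (h : C(Icc (0 : ℝ) T, E)) (v : C(Icc (0 : ℝ) T, W)),
      (∀ t, h t = ∫ s in (0 : ℝ)..t, (A s (IccExtend hT h s) + B s (IccExtend hT v s))) →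
      ⟪ψ, h ⟨T, hT, le_rfl⟩⟫ = 0) :
    ∃ P : ℝ → E, (∃ K, LipschitzWith K P) ∧ (∀ t ∈ Icc 0 T, P t ≠ 0) ∧
      (∀ᵐ t, t ∈ Icc 0 T → HasDerivAt P (-adjoint (A t) (P t)) t) ∧
      ∀ᵐ t, t ∈ Icc 0 T → adjoint (B t) (P t) = 0 := by
  have hA' : IsBoundedMeasurable fun t => -adjoint (A t) :=
    ⟨hA.adjoint.aesm.neg, by simpa using hA.adjoint.bdd⟩
  obtain ⟨P, hPT, ⟨K, hK⟩, hPd⟩ := exists_linear_ode_solution_final hT hA' ψ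
  refine ⟨P, ⟨K, hK⟩, adjoint_solution_ne_zero hT hA hK hPd (hPT ▸ hψ), hPd, ?_⟩
  let P' : C(Icc (0 : ℝ) T, E) := ⟨fun t => P t, hK.continuous.comp continuous_subtype_val⟩
  have hP' := IsBoundedMeasurable.iccExtend hT P'
  have hBP := hB.adjoint.clm_apply hP'
  -- the weak form of the stationarity condition
  have hweak (v : C(Icc (0 : ℝ) T, W)) :
      ∫ s in (0 : ℝ)..T, ⟪adjoint (B s) (IccExtend hT P' s), IccExtend hT v s⟫ = 0 := by
    have hBv := hB.clm_apply (IsBoundedMeasurable.iccExtend hT v)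
    obtain ⟨φ, hφ⟩ := hBv.exists_primitive T
    obtain ⟨h, hh⟩ := exists_linear_volterra_solution hT hA φ
    have hAh := hA.clm_apply (IsBoundedMeasurable.iccExtend hT h)
    have hh' (t : Icc (0 : ℝ) T) :
        h t = ∫ s in (0 : ℝ)..t, (A s (IccExtend hT h s) + B s (IccExtend hT v s)) := by
      rw [hh, hφ, intervalIntegral.integral_add (hAh.intervalIntegrable _ _)
        (hBv.intervalIntegrable _ _), add_comm]
    obtain ⟨K', hK'⟩ := (hAh.add hBv).lipschitz_integral
    have hc : IsBoundedMeasurable fun s => ⟪adjoint (B s) (IccExtend hT P' s), IccExtend hT v s⟫ :=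
      IsBoundedMeasurable.bilin (innerSL ℝ) hBP (IsBoundedMeasurable.iccExtend hT v)
    have key := inner_adjoint_solution_eq hT hK hK' hPd (b := fun s => B s (IccExtend hT v s))
      (by
        filter_upwards [(hAh.add hBv).ae_hasDerivAt] with t ht htm
        rw [← hh' ⟨t, htm⟩]
        rwa [IccExtend_of_mem _ h htm] at ht) hc
      (fun t ht => by
        rw [ContinuousLinearMap.adjoint_inner_left, IccExtend_of_mem _ P' ht]
        rfl) T ⟨hT, le_rfl⟩
    rw [intervalIntegral.integral_same, inner_zero_right, zero_add, hPT] at key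
    exact key.symm.trans ((congrArg (inner ℝ ψ) (hh' _)).symm.trans (hψT h v hh'))
  -- Fundamental lemma of the calculus of variations. The test function `g` need not vanish at `0`
  -- or `T`, because every continuous `v` is allowed in `hweak`; below, `v = g • w` tests the vector
  -- integral against each `w`.
  have hzero : ∀ᵐ t, (Ioc 0 T).indicator (fun s => adjoint (B s) (IccExtend hT P' s)) t = 0 := by
    refine ae_eq_zero_of_integral_contDiff_smul_eq_zero
      (hBP.locallyIntegrable.indicator measurableSet_Ioc) fun g hg _ => ?_
    have h1 : ∫ t, g t • (Ioc 0 T).indicator (fun s => adjoint (B s) (IccExtend hT P' s)) t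
        = ∫ t in (0 : ℝ)..T, g t • adjoint (B t) (IccExtend hT P' t) := by
      rw [intervalIntegral.integral_of_le hT, ← integral_indicator measurableSet_Ioc]
      congr 1
      ext t
      by_cases ht : t ∈ Ioc 0 T <;> simp [ht]
    rw [h1]
    refine ext_inner_right ℝ fun w => ?_
    rw [inner_zero_left, real_inner_comm, ← innerSL_apply_apply ℝ,
      ← ContinuousLinearMap.intervalIntegral_comp_comm]
    · let v : C(Icc (0 : ℝ) T, W) :=
        ⟨fun t => g t • w, (hg.continuous.comp continuous_subtype_val).smul continuous_const⟩
      refine Eq.trans ?_ (hweak v)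
      refine intervalIntegral.integral_congr fun t ht => ?_
      rw [uIcc_of_le hT] at ht
      simp only [innerSL_apply_apply, inner_smul_right]
      rw [IccExtend_of_mem hT v ht, show v ⟨t, ht⟩ = g t • w from rfl, inner_smul_right,
        real_inner_comm]
    · exact (hBP.intervalIntegrable 0 T).continuousOn_smul hg.continuous.continuousOn
  have h0 : ∀ᵐ t : ℝ, t ≠ 0 := by simp [ae_iff]
  filter_upwards [hzero, h0] with t ht ht0 htm
  rw [indicator_of_mem (show t ∈ Ioc 0 T from ⟨lt_of_le_of_ne htm.1 ht0.symm, htm.2⟩), IccExtend_of_mem _ P' htm] at ht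
  exact ht

end Adjoint

/-! ### Gradients of the Hamiltonian and the augmented space. -/

/-- Identifies `∂H̃/∂x̃` and `∂H̃/∂u` with `Aᵀ p` and `Bᵀ p`. -/
theorem gradient_inner_eq_adjoint_fderiv {E Z : Type*} [NormedAddCommGroup E]
    [InnerProductSpace ℝ E] [CompleteSpace E] [NormedAddCommGroup Z] [InnerProductSpace ℝ Z]
    [CompleteSpace Z] {G : Z → E} {D : Z →L[ℝ] E} {z : Z} (hG : HasFDerivAt G D z) (p : E) :
    ∇ (fun z => ⟪p, G z⟫) z = ContinuousLinearMap.adjoint D p := by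
  refine HasGradientAt.gradient (hasGradientAt_iff_hasFDerivAt.2 ?_)
  refine ((innerSL ℝ p).hasFDerivAt.comp z hG).congr_fderiv ?_
  ext w
  simp [ContinuousLinearMap.adjoint_inner_left]

theorem gradient_inner_left {E : Type*} [NormedAddCommGroup E] [InnerProductSpace ℝ E]
    [CompleteSpace E] (c p : E) : ∇ (fun p => ⟪p, c⟫) p = c := by
  have := gradient_inner_eq_adjoint_fderiv (hasFDerivAt_id p) c
  rw [ContinuousLinearMap.adjoint_id] at this
  exact (congrArg (∇ · p) (funext fun q => real_inner_comm _ _)).trans this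

theorem LipschitzWith.comp_absolutelyContinuousOnInterval {X Y : Type*} [PseudoMetricSpace X]
    [PseudoMetricSpace Y] {g : X → Y} {K : NNReal} (hg : LipschitzWith K g) {f : ℝ → X} {a b : ℝ}
    (hf : AbsolutelyContinuousOnInterval f a b) :
    AbsolutelyContinuousOnInterval (fun t => g (f t)) a b := by
  have h := Filter.Tendsto.const_mul (K : ℝ) hf
  rw [mul_zero] at h
  refine squeeze_zero (fun E => Finset.sum_nonneg fun _ _ => dist_nonneg) (fun E => ?_) h
  rw [Finset.mul_sum]
  exact Finset.sum_le_sum fun i _ => hg.dist_le_mul _ _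

/-- The cases `c = d = 1` and `d = 0` give additivity and homogeneity. -/
theorem augment_add_smul {n : ℕ} (c d : ℝ) (x y : Vec n) (a b : ℝ) :
    augment (c • x + d • y) (c * a + d * b) = c • augment x a + d • augment y b := by
  ext i
  refine Fin.lastCases ?_ (fun i => ?_) i <;> simp [augment]

/-- `augment` as a continuous linear map. -/
theorem exists_augment_clm (n : ℕ) :
    ∃ L : (Vec n × ℝ) →L[ℝ] Vec (n + 1), ∀ x c, L (x, c) = augment x c :=
  ⟨LinearMap.toContinuousLinearMap ⟨⟨fun q => augment q.1 q.2, fun p q => by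
    simpa using augment_add_smul 1 1 p.1 q.1 p.2 q.2⟩, fun c q => by
    simpa using augment_add_smul c 0 q.1 0 q.2 0⟩, fun x c => rfl⟩

/-- `statePart` as a continuous linear map. -/
theorem exists_statePart_clm (n : ℕ) :
    ∃ L : Vec (n + 1) →L[ℝ] Vec n, ∀ X, L X = statePart X :=
  ⟨LinearMap.toContinuousLinearMap ⟨⟨statePart, fun p q => by ext; simp [statePart]⟩,
    fun c q => by ext; simp [statePart]⟩, fun X => rfl⟩

@[simp] theorem statePart_augment {n : ℕ} (x : Vec n) (c : ℝ) : statePart (augment x c) = x := by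
  ext i; simp [statePart, augment]

@[simp] theorem augment_last {n : ℕ} (x : Vec n) (c : ℝ) : augment x c (Fin.last n) = c := by
  simp [augment]

theorem contDiff_augDynamics {n m : ℕ} {f : Vec n × Vec m → Vec n} (hf : ContDiff ℝ ∞ f)
    {f0 : Vec n × Vec m → ℝ} (hf0 : ContDiff ℝ ∞ f0) :
    ContDiff ℝ 1 fun q : Vec (n + 1) × Vec m => augDynamics f f0 q.1 q.2 := by
  obtain ⟨L, hL⟩ := exists_augment_clm n
  obtain ⟨S, hS⟩ := exists_statePart_clm n
  have h1 : ContDiff ℝ 1 fun q : Vec (n + 1) × Vec m => (S q.1, q.2) := by fun_prop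
  have h2 := L.contDiff.comp (((hf.of_le (by simp)).comp h1).prodMk ((hf0.of_le (by simp)).comp h1))
  convert! h2 using 1
  ext1 q
  simp [augDynamics, hL, hS]

/-! ### Optimality and the maximum principle. -/

variable {n m : ℕ} {V : Set (Vec n)} {f : Vec n × Vec m → Vec n} {f0 : Vec n × Vec m → ℝ} {T : ℝ}
  {x₀ x₁ : Vec n} {x : ℝ → Vec n} {u : ℝ → Vec m}

theorem IsAdmissibleControl.isBoundedMeasurable_indicator (hu : IsAdmissibleControl T u) :
    IsBoundedMeasurable ((Icc 0 T).indicator u) := by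
  obtain ⟨C, hC⟩ := hu.bounded
  refine ⟨((aemeasurable_indicator_iff measurableSet_Icc).2 hu.measurable).aestronglyMeasurable,
    max C 0, fun t => ?_⟩
  by_cases ht : t ∈ Icc 0 T
  · simpa [ht] using Or.inl (hC t ht)
  · simp [ht]

/-- The augmented trajectory is absolutely continuous and solves the augmented system. -/
theorem IsFeasible.augTrajectory (hT : 0 ≤ T) (hfeas : IsFeasible V f T x₀ x₁ x u)
    (hf0 : Continuous f0) :
    AbsolutelyContinuousOnInterval (augTrajectory f0 x u) 0 T ∧
      ∀ᵐ t, t ∈ Icc 0 T →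
        HasDerivAt (augTrajectory f0 x u) (augDynamics f f0 (augTrajectory f0 x u t) (u t)) t := by
  obtain ⟨L, hL⟩ := exists_augment_clm n
  have hx := hfeas.trajectory.absolutelyContinuous
  let xs : C(Icc (0 : ℝ) T, Vec n) :=
    ⟨fun t => x t, continuousOn_iff_continuous_domRestrict.1 (uIcc_of_le hT ▸ hx.continuousOn)⟩
  have hg : IntervalIntegrable (fun s => f0 (x s, u s)) volume 0 T := by
    -- On `(0, T]` the integrand agrees with a bounded measurable function on the whole line.
    refine (((IsBoundedMeasurable.iccExtend hT xs).prodMk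
      hfeas.control.isBoundedMeasurable_indicator).comp_continuous hf0).intervalIntegrable 0 T
      |>.congr fun s hs => ?_
    rw [uIoc_of_le hT] at hs
    have hs' : s ∈ Icc 0 T := ⟨hs.1.le, hs.2⟩
    simp only [IccExtend_of_mem hT xs hs', indicator_of_mem hs']
    rfl
  have hc := hg.absolutelyContinuousOnInterval_intervalIntegral (c := 0) left_mem_uIcc
  have hdec : _root_.augTrajectory f0 x u = fun t =>
      L (x t, ∫ s in (0 : ℝ)..t, f0 (x s, u s)) := by
    ext1 t; rw [hL]; rfl
  constructor
  · have h1 := ((L.comp (ContinuousLinearMap.inl ℝ _ _)).lipschitz.comp_absolutelyContinuousOnInterval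
      hx).add ((L.comp (ContinuousLinearMap.inr ℝ _ _)).lipschitz.comp_absolutelyContinuousOnInterval
      hc)
    rw [hdec]
    refine (congrArg (AbsolutelyContinuousOnInterval · 0 T) (funext fun t => ?_)).mp h1
    simp [← map_add]
  · filter_upwards [(ae_restrict_iff' measurableSet_Icc).1 hfeas.trajectory.hasDerivAt,
      hg.ae_hasDerivAt_integral] with t h1 h2 ht
    rw [uIcc_of_le hT] at h2
    have h3 := L.hasFDerivAt.comp_hasDerivAt t ((h1 ht).prodMk (h2 ht 0 ⟨le_rfl, hT⟩))
    rw [hdec]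
    refine h3.congr_deriv ?_
    simp [augDynamics, hL]

/-- Reaching the displacement `(0, -δ)` with `δ > 0` would keep the final state and lower the cost
by `δ`. The radius `ε` is chosen so that nearby trajectories stay in `V`. -/
theorem IsOptimal.not_eventually_exists_trajectory (hV : IsOpen V) (hf : Continuous f)
    (hf0 : Continuous f0) (hT : 0 ≤ T) (hopt : IsOptimal V f f0 T x₀ x₁ x u)
    {X : ℝ → Vec (n + 1)} (hX : IsBoundedMeasurable X) {w : ℝ → Vec m}
    (hw : IsBoundedMeasurable w) (hXx : ∀ t ∈ Icc 0 T, X t = augTrajectory f0 x u t)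
    (hXF : ∀ t ∈ Icc 0 T, X t = X 0 + ∫ s in (0 : ℝ)..t, augDynamics f f0 (X s) (w s)) :
    ∃ ε > 0, ¬ ∀ᶠ e in nhds (0 : Vec (n + 1)),
      ∃ (h : C(Icc (0 : ℝ) T, Vec (n + 1))) (v : C(Icc (0 : ℝ) T, Vec m)), ‖h‖ < ε ∧
      (∀ t, h t = (∫ s in (0 : ℝ)..t,
        augDynamics f f0 (X s + IccExtend hT h s) (w s + IccExtend hT v s))
        - ∫ s in (0 : ℝ)..t, augDynamics f f0 (X s) (w s)) ∧ h ⟨T, hT, le_rfl⟩ = e := by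
  obtain ⟨L, hL⟩ := exists_augment_clm n
  obtain ⟨S, hS⟩ := exists_statePart_clm n
  have h0m : (0 : ℝ) ∈ Icc 0 T := ⟨le_rfl, hT⟩
  have hTm : T ∈ Icc 0 T := ⟨hT, le_rfl⟩
  have hac := (hopt.feasible.augTrajectory hT hf0).1.continuousOn
  rw [uIcc_of_le hT] at hac
  obtain ⟨ε, hε, hεV⟩ := (isCompact_Icc.image_of_continuousOn hac).exists_thickening_subset_open
    (hV.preimage S.continuous) (by
      rintro _ ⟨t, ht, rfl⟩
      simpa [hS, augTrajectory] using hopt.feasible.trajectory.mem t ht)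
  refine ⟨ε, hε, fun hev => ?_⟩
  have hcont : Filter.Tendsto (fun δ : ℝ => L (0, -δ)) (nhds 0) (nhds 0) := by
    have : Continuous fun δ : ℝ => L (0, -δ) := by fun_prop
    have h := this.tendsto 0
    rwa [neg_zero, ← Prod.zero_eq_mk, map_zero] at h
  obtain ⟨δ, ⟨h, v, hh, hhF, hhT⟩, hδ⟩ :=
    ((((hcont.eventually hev).filter_mono nhdsWithin_le_nhds).and
      (self_mem_nhdsWithin (s := Ioi (0 : ℝ)))).exists)
  have hFc : Continuous fun q : Vec (n + 1) × Vec m => augDynamics f f0 q.1 q.2 := by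
    have : Continuous fun q : Vec (n + 1) × Vec m => L (f (S q.1, q.2), f0 (S q.1, q.2)) := by
      fun_prop
    simpa only [hL, hS, augDynamics] using this
  set w' : ℝ → Vec m := fun s => w s + IccExtend hT v s with hw'
  have hw'm : IsBoundedMeasurable w' := hw.add (IsBoundedMeasurable.iccExtend hT v)
  set g : ℝ → Vec (n + 1) := fun s => augDynamics f f0 (X s + IccExtend hT h s) (w' s) with hg
  have hgm : IsBoundedMeasurable g :=
    ((hX.add (IsBoundedMeasurable.iccExtend hT h)).prodMk hw'm).comp_continuous hFc
  -- `Y` is the competitor `X + h` on `[0, T]`, written as a primitive so that it is Lipschitz and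
  -- differentiable almost everywhere on the line.
  set Y : ℝ → Vec (n + 1) := fun t => X 0 + ∫ s in (0 : ℝ)..t, g s with hY
  have hYX (t : ℝ) (ht : t ∈ Icc 0 T) : Y t = X t + h ⟨t, ht⟩ := by
    rw [hhF, hXF t ht]
    simp only [hY]
    abel
  have hgY (t : ℝ) (ht : t ∈ Icc 0 T) : g t = augment (f (S (Y t), w' t)) (f0 (S (Y t), w' t)) := by
    simp only [hg, augDynamics]
    rw [IccExtend_of_mem _ _ ht, ← hYX t ht, hS]
  obtain ⟨K, hK⟩ := hgm.lipschitz_integral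
  have hYT : Y T = X T + augment 0 (-δ) := by rw [hYX T hTm, hhT, hL]
  have hfeas : IsFeasible V f T x₀ x₁ (fun t => S (Y t)) w' := by
    refine ⟨⟨hw'm.aesm.aemeasurable.restrict, ?_⟩, ⟨?_, fun t ht => ?_, ?_⟩, ?_, ?_⟩
    · obtain ⟨C, hC⟩ := hw'm.bdd
      exact ⟨C, fun t _ => hC t⟩
    · refine S.lipschitz.comp_absolutelyContinuousOnInterval ?_
      have := (LipschitzWith.const (X 0)).add hK
      exact (this.lipschitzOnWith (s := uIcc 0 T)).absolutelyContinuousOnInterval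
    · refine hεV (Metric.mem_thickening_iff.2 ⟨_, mem_image_of_mem _ ht, ?_⟩)
      rw [← hXx t ht, hYX t ht, dist_eq_norm, add_sub_cancel_left]
      exact (h.norm_coe_le_norm _).trans_lt hh
    · rw [ae_restrict_iff' measurableSet_Icc]
      filter_upwards [hgm.ae_hasDerivAt] with t ht htm
      have h1 := S.hasFDerivAt.comp_hasDerivAt t (ht.const_add (X 0))
      rwa [hgY t htm, hS, statePart_augment] at h1
    · simp only [hY, intervalIntegral.integral_same, add_zero]
      rw [hXx 0 h0m, hS]
      simpa [augTrajectory] using hopt.feasible.initial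
    · rw [hYT, hXx T hTm, map_add, hS, hS]
      simpa [augTrajectory] using hopt.feasible.final
  have hcost : cost f0 T (fun t => S (Y t)) w' = cost f0 T x u - δ := by
    have h1 : cost f0 T (fun t => S (Y t)) w' = ∫ s in (0 : ℝ)..T, g s (Fin.last n) := by
      refine intervalIntegral.integral_congr fun t ht => ?_
      rw [uIcc_of_le hT] at ht
      simp only [hgY t ht, augment_last]
    have h2 : ∫ s in (0 : ℝ)..T, g s (Fin.last n) = (∫ s in (0 : ℝ)..T, g s) (Fin.last n) :=
      (EuclideanSpace.proj (𝕜 := ℝ) (Fin.last n)).intervalIntegral_comp_comm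
        (hgm.intervalIntegrable _ _)
    have h3 : ∫ s in (0 : ℝ)..T, g s = Y T - X 0 := by simp [hY]
    rw [h1, h2, h3, hYT, hXx T hTm, hXx 0 h0m]
    simp [augTrajectory, cost, sub_eq_add_neg]
  have := hopt.minimal _ _ hfeas
  rw [hcost] at this
  have hδ' : 0 < δ := hδ
  linarith

theorem mainTheorem2 {n m : ℕ} (V : Set (Vec n)) (hV : IsOpen V)
    (f : Vec n × Vec m → Vec n) (hf : ContDiff ℝ ∞ f)
    (f0 : Vec n × Vec m → ℝ) (hf0 : ContDiff ℝ ∞ f0)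
    (T : ℝ) (hT : 0 < T) (x₀ x₁ : Vec n)
    (x : ℝ → Vec n) (u : ℝ → Vec m) (hopt : IsOptimal V f f0 T x₀ x₁ x u) :
    ∃ P : ℝ → Vec (n + 1),
      (∀ t ∈ Icc 0 T, P t ≠ 0) ∧ IsExtremal f f0 T (augTrajectory f0 x u) P u := by
  have hT0 := hT.le
  obtain ⟨hXac, hXd⟩ := hopt.feasible.augTrajectory hT0 hf0.continuous
  have hF := contDiff_augDynamics hf hf0
  have hw := hopt.feasible.control.isBoundedMeasurable_indicator
  -- The control is cut off to zero and the state extended by its end values, so both are bounded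
  -- measurable on the whole line; only their values on `[0, T]` enter the conclusion.
  set w := (Icc 0 T).indicator u with hwdef
  have hwu (t : ℝ) (ht : t ∈ Icc 0 T) : w t = u t := indicator_of_mem ht u
  let Xs : C(Icc (0 : ℝ) T, Vec (n + 1)) := ⟨fun t => augTrajectory f0 x u t,
    continuousOn_iff_continuous_domRestrict.1 (uIcc_of_le hT0 ▸ hXac.continuousOn)⟩
  have hX := IsBoundedMeasurable.iccExtend hT0 Xs
  set X := IccExtend hT0 Xs with hXdef
  have hXx (t : ℝ) (ht : t ∈ Icc 0 T) : X t = augTrajectory f0 x u t := IccExtend_of_mem hT0 Xs ht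
  have hXF (t : ℝ) (ht : t ∈ Icc 0 T) :
      X t = X 0 + ∫ s in (0 : ℝ)..t, augDynamics f f0 (X s) (w s) := by
    rw [hXx t ht, hXx 0 ⟨le_rfl, hT0⟩]
    refine ((hX.prodMk hw).comp_continuous hF.continuous).eq_add_integral hT0 hXac ?_ t ht
    filter_upwards [hXd] with s hs hsm
    rw [hXx s hsm, hwu s hsm]
    exact hs hsm
  let F : Vec (n + 1) × Vec m → Vec (n + 1) := fun q => augDynamics f f0 q.1 q.2
  obtain ⟨ε, hε, hnot⟩ := hopt.not_eventually_exists_trajectory hV hf.continuous hf0.continuous hT0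
    hX hw hXx hXF
  -- Contraposition of openness supplies the form `ψ` that vanishes at all linearized end points.
  have hnc := mt (fun hc => eventually_exists_trajectory_of_linearized_controllable (F := F) hF hX
    hw hT0 hc hε) hnot
  push Not at hnc
  obtain ⟨ψ, hψ, hψT⟩ := hnc
  have hD : Continuous (fderiv ℝ F) := hF.continuous_fderiv one_ne_zero
  have hA : IsBoundedMeasurable fun s =>
      (fderiv ℝ F (X s, w s)).comp (ContinuousLinearMap.inl ℝ _ _) :=
    (hX.prodMk hw).comp_continuous
      (φ := fun q => (fderiv ℝ F q).comp (ContinuousLinearMap.inl ℝ _ _))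
      (hD.clm_comp continuous_const)
  have hB : IsBoundedMeasurable fun s =>
      (fderiv ℝ F (X s, w s)).comp (ContinuousLinearMap.inr ℝ _ _) :=
    (hX.prodMk hw).comp_continuous
      (φ := fun q => (fderiv ℝ F q).comp (ContinuousLinearMap.inr ℝ _ _))
      (hD.clm_comp continuous_const)
  obtain ⟨P, ⟨K, hK⟩, hP0, hPd, hPB⟩ := exists_adjoint_vector hT0 hA hB hψ fun h v hhv =>
    hψT h v fun t => by
      rw [hhv t]
      simp [← map_add]
  have hfd (t : ℝ) : HasFDerivAt F (fderiv ℝ F (X t, w t)) (X t, w t) :=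
    (hF.differentiable one_ne_zero _).hasFDerivAt
  refine ⟨P, hP0, hXac, (hK.lipschitzOnWith (s := uIcc 0 T)).absolutelyContinuousOnInterval,
    ?_, ?_, ?_⟩ <;> rw [ae_restrict_iff' measurableSet_Icc]
  · filter_upwards [hXd] with t ht htm
    simp only [augHamiltonian]
    rw [gradient_inner_left]
    exact ht htm
  · filter_upwards [hPd] with t ht htm
    have h1 := gradient_inner_eq_adjoint_fderiv
      ((hfd t).comp (X t) (hasFDerivAt_prodMk_left (X t) (w t))) (P t)
    rw [← hXx t htm, ← hwu t htm]
    exact (ht htm).congr_deriv (congrArg Neg.neg h1.symm)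
  · filter_upwards [hPB] with t ht htm
    have h1 := gradient_inner_eq_adjoint_fderiv
      ((hfd t).comp (w t) (hasFDerivAt_prodMk_right (X t) (w t))) (P t)
    rw [← hXx t htm, ← hwu t htm]
    exact h1.trans (ht htm)
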